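/- Let $G$ be a locally compact (Hausdorff) group with left Haar measure and modular function $\Delta$, let $M(G)$ be the space of regular complex Borel measures on $G$, and let $\rho$ be the right regular representation of $G$ on $L^2(G)$, $(\rho_r f)(s)=\Delta(r)^{1/2}f(sr)$. Let $\mathcal T(G)$ be the trace class on $L^2(G)$, regarded as the predual of $\mathcal B(L^2(G))$ via the pairing $\langle T,h\rangle_t=\sum_i (Tf_i,\bar g_i)$ for $h(x,y)=\sum_i f_i(x)g_i(y)$ with $\sum_i\|f_i\|_2^2<\infty$, $\sum_i\|g_i\|_2^2<\infty$, and with norm $\|h\|_t=\inf\sum_i\|f_i\|_2\|g_i\|_2$ over all such representations of $h$. For $\mu\in M(G)$ and $T\in\mathcal B(L^2(G))$ let $\Theta(\mu)(T)\in\mathcal B(L^2(G))$ be the operator determined by $$\langle\Theta(\mu)(T),h\rangle_t=\int_G\langle\rho_rT\rho_r^*,h\rangle_t\,d\mu(r)\qquad(h\in\mathcal T(G)).$$ Let $\theta_r:\mathcal T(G)\to\mathcal T(G)$ be the predual of $T\mapsto\rho_rT\rho_r^*$, and for $f\in L^1(G)$ put $\theta(f)(h)=\int_G f(r)\,\theta_r(h)\,dr$.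 For a closed subspace $J\subseteq L^1(G)$ put $$\operatorname{Ran}J=\overline{\operatorname{span}}^{\|\cdot\|_t}\{\theta(f)(h): f\in J,\ h\in\mathcal T(G)\}\subseteq\mathcal T(G),$$ and let $(\operatorname{Ran}J)^\perp=\{T\in\mathcal B(L^2(G)):\langle T,h\rangle_t=0\text{ for all }h\in\operatorname{Ran}J\}$. **Theorem.** For every subset $\Lambda\subseteq M(G)$, let $J_\Lambda\subseteq L^1(G)$ be the norm closed linear span of $\{f*\mu-f: f\in L^1(G),\ \mu\in\Lambda\}$, where $(f*\mu)(x)=\int_G\Delta(y^{-1})f(xy^{-1})\,d\mu(y)$. Then the space $\widetilde{\mathcal H}(\Lambda)=\{T\in\mathcal B(L^2(G)):\Theta(\mu)(T)=T\text{ for all }\mu\in\Lambda\}$ of jointly $\Lambda$-harmonic operators satisfies $$\widetilde{\mathcal H}(\Lambda)=(\operatorname{Ran}J_\Lambda)^\perp.$$ -/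

import Mathlib

noncomputable section

open MeasureTheory Filter Topology
open scoped ENNReal NNReal

namespace JointlyHarmonic

section TraceClass

theorem summable_sumElim {H : Type*} [NormedAddCommGroup H] {f g f' g' : ℕ → H} (s1 : Summable (fun i => ‖f i‖ * ‖g i‖))
    (s2 : Summable (fun i => ‖f' i‖ * ‖g' i‖)) :
    Summable (fun i : ℕ ⊕ ℕ => ‖Sum.elim f f' i‖ * ‖Sum.elim g g' i‖) :=
  Summable.sum (fun i : ℕ ⊕ ℕ => ‖Sum.elim f f' i‖ * ‖Sum.elim g g' i‖) s1 s2

variable {H : Type*} [NormedAddCommGroup H] [InnerProductSpace ℂ H]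

/-- `Represents f g φ` says that `φ` is the functional `T ↦ ∑ᵢ (T fᵢ, gᵢ)` on `B(H)`, where
`∑ᵢ ‖fᵢ‖² < ∞` and `∑ᵢ ‖gᵢ‖² < ∞` (Mathlib's inner product is linear in its second argument).
For `H = L²(G)` it is the functional of the kernel `h(x, y) = ∑ᵢ fᵢ(x) ḡᵢ(y)`. -/
def Represents (f g : ℕ → H) (φ : (H →L[ℂ] H) →L[ℂ] ℂ) : Prop :=
  Summable (fun i => ‖f i‖ ^ 2) ∧ Summable (fun i => ‖g i‖ ^ 2) ∧
    ∀ T : H →L[ℂ] H, φ T = ∑' i, inner ℂ (g i) (T (f i))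

theorem Represents.summable {f g : ℕ → H} {φ : (H →L[ℂ] H) →L[ℂ] ℂ} (h : Represents f g φ) :
    Summable (fun i => ‖f i‖ * ‖g i‖) := by
  refine Summable.of_nonneg_of_le (fun i => by positivity) (fun i => ?_) (h.1.add h.2.1)
  nlinarith [sq_nonneg (‖f i‖ - ‖g i‖), sq_nonneg (‖f i‖), sq_nonneg (‖g i‖)]

theorem norm_term_le (T : H →L[ℂ] H) (x y : H) :
    ‖(inner ℂ y (T x) : ℂ)‖ ≤ ‖T‖ * (‖x‖ * ‖y‖) := by
  calc ‖(inner ℂ y (T x) : ℂ)‖ ≤ ‖y‖ * ‖T x‖ := norm_inner_le_norm _ _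
    _ ≤ ‖y‖ * (‖T‖ * ‖x‖) := by gcongr; exact T.le_opNorm x
    _ = _ := by ring

theorem summable_term {ι : Type*} {f g : ι → H} (hs : Summable (fun i => ‖f i‖ * ‖g i‖))
    (T : H →L[ℂ] H) : Summable (fun i => (inner ℂ (g i) (T (f i)) : ℂ)) :=
  Summable.of_norm_bounded (hs.mul_left ‖T‖) (fun _ => norm_term_le _ _ _)

/-- Every countable family with `∑ ‖fᵢ‖ ‖gᵢ‖ < ∞` can be balanced into square summable sequences
with the same functional and the same sum of products of norms. -/
theorem exists_represents {ι : Type*} [Countable ι] {f g : ι → H}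
    (hs : Summable (fun i => ‖f i‖ * ‖g i‖)) {φ : (H →L[ℂ] H) →L[ℂ] ℂ}
    (hφ : ∀ T : H →L[ℂ] H, φ T = ∑' i, inner ℂ (g i) (T (f i))) :
    ∃ F K : ℕ → H, Represents F K φ ∧ ∑' i, ‖F i‖ * ‖K i‖ = ∑' i, ‖f i‖ * ‖g i‖ := by
  classical
  obtain ⟨e, he⟩ := exists_injective_nat ι
  have key : ∀ i, ∃ x y : H, ‖x‖ ^ 2 = ‖f i‖ * ‖g i‖ ∧ ‖y‖ ^ 2 = ‖f i‖ * ‖g i‖ ∧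
      ‖x‖ * ‖y‖ = ‖f i‖ * ‖g i‖ ∧
      ∀ T : H →L[ℂ] H, (inner ℂ y (T x) : ℂ) = inner ℂ (g i) (T (f i)) := by
    intro i
    by_cases h0 : ‖f i‖ * ‖g i‖ = 0
    · refine ⟨0, 0, by simp [h0], by simp [h0], by simp [h0], fun T => ?_⟩
      rcases mul_eq_zero.1 h0 with h | h
      · simp [norm_eq_zero.1 h]
      · simp [norm_eq_zero.1 h]
    · have hf : 0 < ‖f i‖ := lt_of_le_of_ne (norm_nonneg _) (fun h => h0 (by simp [← h]))
      have hg : 0 < ‖g i‖ := lt_of_le_of_ne (norm_nonneg _) (fun h => h0 (by simp [← h]))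
      set c : ℝ := Real.sqrt (‖g i‖ / ‖f i‖) with hc
      have hc0 : 0 < c := Real.sqrt_pos.2 (by positivity)
      have hc2 : c ^ 2 = ‖g i‖ / ‖f i‖ := Real.sq_sqrt (by positivity)
      have e1 : ‖((c : ℂ)) • f i‖ = c * ‖f i‖ := by
        rw [norm_smul, Complex.norm_real, Real.norm_of_nonneg hc0.le]
      have e2 : ‖((c⁻¹ : ℝ) : ℂ) • g i‖ = c⁻¹ * ‖g i‖ := by
        rw [norm_smul, Complex.norm_real, Real.norm_of_nonneg (by positivity)]
      refine ⟨(c : ℂ) • f i, ((c⁻¹ : ℝ) : ℂ) • g i, ?_, ?_, ?_, fun T => ?_⟩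
      · rw [e1, mul_pow, hc2]; field_simp
      · rw [e2, mul_pow, inv_pow, hc2]; field_simp
      · rw [e1, e2]; field_simp
      · rw [map_smul, inner_smul_left, inner_smul_right, Complex.conj_ofReal, ← mul_assoc,
          ← Complex.ofReal_mul, inv_mul_cancel₀ hc0.ne']
        simp
  choose x y hx hy hxy hT using key
  have hout : ∀ (z : ι → H) (n : ℕ), n ∉ Set.range e → Function.extend e z 0 n = 0 := by
    intro z n hn
    exact Function.extend_apply' _ _ _ (fun ⟨a, ha⟩ => hn ⟨a, ha⟩)
  have hin : ∀ (z : ι → H) (i : ι), Function.extend e z 0 (e i) = z i := fun z i =>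
    he.extend_apply _ _ _
  refine ⟨Function.extend e x 0, Function.extend e y 0, ⟨?_, ?_, fun T => ?_⟩, ?_⟩
  · rw [← he.summable_iff (fun n hn => by simp [hout x n hn])]
    simpa [Function.comp_def, hin, hx] using hs
  · rw [← he.summable_iff (fun n hn => by simp [hout y n hn])]
    simpa [Function.comp_def, hin, hy] using hs
  · rw [hφ, ← he.tsum_eq (f := fun n => (inner ℂ (Function.extend e y 0 n)
      (T (Function.extend e x 0 n)) : ℂ))]
    · simp [hin, hT]
    · intro n hn
      by_contra hn'
      exact hn (by simp [hout x n hn'])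
  · rw [← he.tsum_eq (f := fun n => ‖Function.extend e x 0 n‖ * ‖Function.extend e y 0 n‖)]
    · simp [hin, hxy]
    · intro n hn
      by_contra hn'
      exact hn (by simp [hout x n hn'])

variable (H) in
/-- The functionals on `B(H)` of the form `T ↦ ∑ᵢ (T fᵢ, gᵢ)` with `∑ᵢ ‖fᵢ‖² < ∞`,
`∑ᵢ ‖gᵢ‖² < ∞`. -/
def normalFunctionals : Submodule ℂ ((H →L[ℂ] H) →L[ℂ] ℂ) where
  carrier := {φ | ∃ f g : ℕ → H, Represents f g φ}
  zero_mem' := ⟨0, 0, by simp [Represents]⟩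
  add_mem' := by
    rintro φ ψ ⟨f, g, h⟩ ⟨f', g', h'⟩
    have hs : Summable (fun i : ℕ ⊕ ℕ => ‖Sum.elim f f' i‖ * ‖Sum.elim g g' i‖) :=
      summable_sumElim h.summable h'.summable
    obtain ⟨F, K, hFK, -⟩ := exists_represents (φ := φ + ψ) hs (fun T => by
      have := Summable.tsum_sum
        (f := fun i : ℕ ⊕ ℕ => (inner ℂ (Sum.elim g g' i) (T (Sum.elim f f' i)) : ℂ))
        (summable_term h.summable T) (summable_term h'.summable T)
      rw [this]
      simp [h.2.2 T, h'.2.2 T])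
    exact ⟨F, K, hFK⟩
  smul_mem' := by
    rintro c φ ⟨f, g, h⟩
    refine ⟨fun i => c • f i, g, ?_, h.2.1, fun T => ?_⟩
    · simpa [norm_smul, mul_pow] using h.1.mul_left (‖c‖ ^ 2)
    · simp [h.2.2 T, tsum_mul_left]

variable (H) in
/-- The space of trace class operators on `H`, realised as the predual of `B(H)`. -/
def TraceClass : Type _ := normalFunctionals H

namespace TraceClass

instance : AddCommGroup (TraceClass H) := inferInstanceAs (AddCommGroup (normalFunctionals H))
instance : Module ℂ (TraceClass H) := inferInstanceAs (Module ℂ (normalFunctionals H))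

/-- The pairing `⟨T, h⟩ₜ` between `B(H)` and its predual. -/
def pairing (T : H →L[ℂ] H) (h : TraceClass H) : ℂ := h.1 T

@[ext] theorem ext {h k : TraceClass H} (hk : ∀ T, pairing T h = pairing T k) : h = k :=
  Subtype.ext (ContinuousLinearMap.ext hk)

@[simp] theorem pairing_zero (T : H →L[ℂ] H) : pairing T (0 : TraceClass H) = 0 := rfl
@[simp] theorem pairing_add (T : H →L[ℂ] H) (h k : TraceClass H) :
    pairing T (h + k) = pairing T h + pairing T k := rfl
@[simp] theorem pairing_smul (T : H →L[ℂ] H) (c : ℂ) (h : TraceClass H) :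
    pairing T (c • h) = c * pairing T h := rfl

theorem pairing_sub (T : H →L[ℂ] H) (h k : TraceClass H) :
    pairing T (h - k) = pairing T h - pairing T k := rfl

/-- The trace norm `‖h‖ₜ = inf ∑ᵢ ‖fᵢ‖ ‖gᵢ‖`, over all representations of `h`. -/
instance : Norm (TraceClass H) :=
  ⟨fun h => sInf {c : ℝ | ∃ f g : ℕ → H, Represents f g h.1 ∧ c = ∑' i, ‖f i‖ * ‖g i‖}⟩

theorem norm_def (h : TraceClass H) :
    ‖h‖ = sInf {c : ℝ | ∃ f g : ℕ → H, Represents f g h.1 ∧ c = ∑' i, ‖f i‖ * ‖g i‖} := rfl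

theorem bddBelow (h : TraceClass H) : BddBelow
    {c : ℝ | ∃ f g : ℕ → H, Represents f g h.1 ∧ c = ∑' i, ‖f i‖ * ‖g i‖} :=
  ⟨0, by rintro c ⟨f, g, -, rfl⟩; exact tsum_nonneg fun i => by positivity⟩

theorem norm_le_tsum {ι : Type*} [Countable ι] {f g : ι → H}
    (hs : Summable (fun i => ‖f i‖ * ‖g i‖)) (h : TraceClass H)
    (hφ : ∀ T : H →L[ℂ] H, pairing T h = ∑' i, inner ℂ (g i) (T (f i))) :
    ‖h‖ ≤ ∑' i, ‖f i‖ * ‖g i‖ := by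
  obtain ⟨F, K, hFK, e⟩ := exists_represents hs hφ
  rw [← e]
  exact csInf_le (bddBelow h) ⟨F, K, hFK, rfl⟩

theorem exists_lt (h : TraceClass H) {ε : ℝ} (hε : 0 < ε) :
    ∃ f g : ℕ → H, Represents f g h.1 ∧ ∑' i, ‖f i‖ * ‖g i‖ < ‖h‖ + ε := by
  obtain ⟨c, ⟨f, g, hr, rfl⟩, hc⟩ := exists_lt_of_csInf_lt
    (s := {c : ℝ | ∃ f g : ℕ → H, Represents f g h.1 ∧ c = ∑' i, ‖f i‖ * ‖g i‖})
    (by obtain ⟨f, g, hr⟩ := h.2; exact ⟨_, f, g, hr, rfl⟩)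
    (lt_add_of_pos_right ‖h‖ hε)
  exact ⟨f, g, hr, hc⟩

theorem norm_pairing_le (T : H →L[ℂ] H) (h : TraceClass H) : ‖pairing T h‖ ≤ ‖T‖ * ‖h‖ := by
  refine le_of_forall_pos_le_add fun ε hε => ?_
  obtain ⟨f, g, hr, hc⟩ := exists_lt h (ε := ε / (‖T‖ + 1)) (by positivity)
  have h1 : ‖pairing T h‖ ≤ ∑' i, ‖T‖ * (‖f i‖ * ‖g i‖) := by
    rw [pairing, hr.2.2 T]
    exact tsum_of_norm_bounded (hr.summable.mul_left ‖T‖).hasSum (fun i => norm_term_le _ _ _)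
  rw [tsum_mul_left] at h1
  have h2 : ‖T‖ * (ε / (‖T‖ + 1)) ≤ ε := by
    rw [mul_div_assoc', div_le_iff₀ (by positivity)]
    nlinarith [norm_nonneg T]
  have h3 := mul_le_mul_of_nonneg_left hc.le (norm_nonneg T)
  linarith

theorem norm_nonneg' (h : TraceClass H) : 0 ≤ ‖h‖ :=
  Real.sInf_nonneg (by rintro c ⟨f, g, -, rfl⟩; exact tsum_nonneg fun i => by positivity)

theorem norm_smul_le' (c : ℂ) (h : TraceClass H) : ‖c • h‖ ≤ ‖c‖ * ‖h‖ := by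
  refine le_of_forall_pos_le_add fun ε hε => ?_
  obtain ⟨f, g, hr, hc⟩ := exists_lt h (ε := ε / (‖c‖ + 1)) (by positivity)
  have h1 : ‖c • h‖ ≤ ∑' i, ‖c • f i‖ * ‖g i‖ := by
    refine norm_le_tsum ?_ _ fun T => ?_
    · simpa [norm_smul, mul_assoc] using hr.summable.mul_left ‖c‖
    · have := hr.2.2 T
      rw [pairing_smul, pairing, this]
      simp [tsum_mul_left]
  simp only [norm_smul, mul_assoc, tsum_mul_left] at h1
  have h2 : ‖c‖ * (ε / (‖c‖ + 1)) ≤ ε := by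
    rw [mul_div_assoc', div_le_iff₀ (by positivity)]
    nlinarith [norm_nonneg c]
  have h3 := mul_le_mul_of_nonneg_left hc.le (norm_nonneg c)
  linarith

theorem core : NormedSpace.Core ℂ (TraceClass H) where
  norm_nonneg := norm_nonneg'
  norm_smul c h := by
    refine le_antisymm (norm_smul_le' c h) ?_
    by_cases hc : c = 0
    · simp [hc, norm_nonneg']
    · have := norm_smul_le' c⁻¹ (c • h)
      rw [inv_smul_smul₀ hc, norm_inv] at this
      have hc' : 0 < ‖c‖ := norm_pos_iff.2 hc
      calc ‖c‖ * ‖h‖ ≤ ‖c‖ * (‖c‖⁻¹ * ‖c • h‖) := by gcongr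
        _ = ‖c • h‖ := by field_simp
  norm_triangle h k := by
    refine le_of_forall_pos_le_add fun ε hε => ?_
    obtain ⟨f, g, hr, hc⟩ := exists_lt h (half_pos hε)
    obtain ⟨f', g', hr', hc'⟩ := exists_lt k (half_pos hε)
    have s1 : Summable ((fun i : ℕ ⊕ ℕ => ‖Sum.elim f f' i‖ * ‖Sum.elim g g' i‖) ∘ Sum.inl) := by
      simpa using! hr.summable
    have s2 : Summable ((fun i : ℕ ⊕ ℕ => ‖Sum.elim f f' i‖ * ‖Sum.elim g g' i‖) ∘ Sum.inr) := by
      simpa using! hr'.summable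
    have h1 := norm_le_tsum (summable_sumElim hr.summable hr'.summable) (h + k) (fun T => by
      have := Summable.tsum_sum
        (f := fun i : ℕ ⊕ ℕ => (inner ℂ (Sum.elim g g' i) (T (Sum.elim f f' i)) : ℂ))
        (summable_term hr.summable T) (summable_term hr'.summable T)
      rw [this, pairing_add, pairing, pairing, hr.2.2 T, hr'.2.2 T]
      simp)
    rw [Summable.tsum_sum s1 s2] at h1
    simp only [Sum.elim_inl, Sum.elim_inr] at h1
    linarith
  norm_eq_zero_iff h := by
    constructor
    · intro h0
      ext T
      have := norm_pairing_le T h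
      rw [h0, mul_zero] at this
      simpa using! norm_le_zero_iff.1 this
    · rintro rfl
      refine le_antisymm ?_ (norm_nonneg' _)
      have := norm_le_tsum (f := fun _ : ℕ => (0 : H)) (g := fun _ => 0) (by simp)
        (0 : TraceClass H) (by simp)
      simpa using this

instance : NormedAddCommGroup (TraceClass H) := NormedAddCommGroup.ofCore core
instance : NormedSpace ℂ (TraceClass H) := NormedSpace.ofCore core

/-- The pairing with a fixed operator as a bounded functional on the predual. -/
def pairingCLM (T : H →L[ℂ] H) : TraceClass H →L[ℂ] ℂ :=
  LinearMap.mkContinuous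
    { toFun := pairing T
      map_add' := pairing_add T
      map_smul' := pairing_smul T } ‖T‖ (norm_pairing_le T)

@[simp] theorem pairingCLM_apply (T : H →L[ℂ] H) (h : TraceClass H) :
    pairingCLM T h = pairing T h := rfl

theorem exists_pairing_eq {ι : Type*} [Countable ι] {f g : ι → H}
    (hs : Summable (fun i => ‖f i‖ * ‖g i‖)) :
    ∃ h : TraceClass H, ∀ T, pairing T h = ∑' i, inner ℂ (g i) (T (f i)) := by
  let L : (H →L[ℂ] H) →ₗ[ℂ] ℂ :=
    { toFun := fun T => ∑' i, inner ℂ (g i) (T (f i))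
      map_add' := fun S T => by
        rw [← (summable_term hs S).tsum_add (summable_term hs T)]
        simp
      map_smul' := fun c T => by simp [tsum_mul_left] }
  let φ : (H →L[ℂ] H) →L[ℂ] ℂ := L.mkContinuous (∑' i, ‖f i‖ * ‖g i‖) fun T => by
    rw [mul_comm, ← tsum_mul_left]
    exact tsum_of_norm_bounded (hs.mul_left ‖T‖).hasSum (fun i => norm_term_le T _ _)
  have hφ : ∀ T : H →L[ℂ] H, φ T = ∑' i, inner ℂ (g i) (T (f i)) := fun T => rfl
  obtain ⟨F, K, hFK, -⟩ := exists_represents hs hφ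
  exact ⟨⟨φ, F, K, hFK⟩, hφ⟩

theorem pairing_sum (T : H →L[ℂ] H) (u : ℕ → TraceClass H) (n : ℕ) :
    pairing T (∑ k ∈ Finset.range n, u k) = ∑ k ∈ Finset.range n, pairing T (u k) :=
  map_sum (pairingCLM T) u (Finset.range n)

theorem norm_sub_sum_le {f g : ℕ → ℕ → H} {u : ℕ → TraceClass H} {a : TraceClass H}
    (hr : ∀ k, Represents (f k) (g k) (u k).1)
    (hk : Summable (fun k => ∑' i, ‖f k i‖ * ‖g k i‖))
    (ha : ∀ T, pairing T a = ∑' p : ℕ × ℕ, inner ℂ (g p.1 p.2) (T (f p.1 p.2))) (n : ℕ) :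
    ‖a - ∑ k ∈ Finset.range n, u k‖ ≤ ∑' k, ∑' i, ‖f (k + n) i‖ * ‖g (k + n) i‖ := by
  have hs : Summable (fun p : ℕ × ℕ => ‖f p.1 p.2‖ * ‖g p.1 p.2‖) :=
    (summable_prod_of_nonneg (fun p => by positivity)).2 ⟨fun k => (hr k).summable, hk⟩
  have hsn : Summable (fun p : ℕ × ℕ => ‖f (p.1 + n) p.2‖ * ‖g (p.1 + n) p.2‖) :=
    (summable_prod_of_nonneg (fun p => by positivity)).2
      ⟨fun k => (hr (k + n)).summable,
        (summable_nat_add_iff (f := fun k => ∑' i, ‖f k i‖ * ‖g k i‖) n).2 hk⟩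
  have h0 : ∀ T, pairing T (a - ∑ k ∈ Finset.range n, u k) =
      ∑' p : ℕ × ℕ, inner ℂ (g (p.1 + n) p.2) (T (f (p.1 + n) p.2)) := by
    intro T
    have t1 := summable_term (f := fun p : ℕ × ℕ => f p.1 p.2) (g := fun p => g p.1 p.2) hs T
    have t2 := summable_term (f := fun p : ℕ × ℕ => f (p.1 + n) p.2)
      (g := fun p => g (p.1 + n) p.2) hsn T
    have e1 : ∀ k, ∑' i, (inner ℂ (g k i) (T (f k i)) : ℂ) = pairing T (u k) := fun k =>
      ((hr k).2.2 T).symm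
    have e3 : Summable (fun k => pairing T (u k)) := by
      have := t1.prod
      simpa only [e1] using this
    have e4 := e3.sum_add_tsum_nat_add n
    rw [pairing_sub, ha, pairing_sum, t1.tsum_prod, t2.tsum_prod]
    simp only [e1]
    rw [← e4]
    ring
  have h1 := norm_le_tsum (f := fun p : ℕ × ℕ => f (p.1 + n) p.2)
      (g := fun p => g (p.1 + n) p.2) hsn _ h0
  rwa [hsn.tsum_prod] at h1

instance : CompleteSpace (TraceClass H) := by
  refine NormedAddCommGroup.completeSpace_of_summable_imp_tendsto fun u hu => ?_
  have hgeo : Summable (fun k : ℕ => (1 / 2 : ℝ) ^ k) := summable_geometric_two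
  choose f g hr hlt using fun k => exists_lt (u k) (ε := (1 / 2 : ℝ) ^ k) (by positivity)
  have hk : Summable (fun k => ∑' i, ‖f k i‖ * ‖g k i‖) :=
    Summable.of_nonneg_of_le (fun k => tsum_nonneg fun i => by positivity) (fun k => (hlt k).le)
      (hu.add hgeo)
  have hs : Summable (fun p : ℕ × ℕ => ‖f p.1 p.2‖ * ‖g p.1 p.2‖) :=
    (summable_prod_of_nonneg (fun p => by positivity)).2 ⟨fun k => (hr k).summable, hk⟩
  obtain ⟨a, ha⟩ := exists_pairing_eq (f := fun p : ℕ × ℕ => f p.1 p.2)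
    (g := fun p => g p.1 p.2) hs
  refine ⟨a, ?_⟩
  have lim := tendsto_sum_nat_add (fun k => ∑' i, ‖f k i‖ * ‖g k i‖)
  rw [tendsto_iff_norm_sub_tendsto_zero]
  refine squeeze_zero (fun n => norm_nonneg _) (fun n => ?_) lim
  rw [norm_sub_rev]
  exact norm_sub_sum_le hr hk ha n

end TraceClass

end TraceClass
section Duality

variable {H : Type*} [NormedAddCommGroup H] [InnerProductSpace ℂ H]

namespace TraceClass

/-- The element `T ↦ (T x, y)` of the predual. -/
theorem exists_rankOne (x y : H) :
    ∃ h : TraceClass H, ∀ T, pairing T h = inner ℂ y (T x) := by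
  obtain ⟨h, hh⟩ := exists_pairing_eq (ι := Unit) (f := fun _ => x) (g := fun _ => y)
    (Summable.of_finite)
  exact ⟨h, fun T => by simpa using hh T⟩

/-- The element `T ↦ (T x, y)` of the predual. -/
def rankOne (x y : H) : TraceClass H := (exists_rankOne x y).choose

@[simp] theorem pairing_rankOne (T : H →L[ℂ] H) (x y : H) :
    pairing T (rankOne x y) = inner ℂ y (T x) := (exists_rankOne x y).choose_spec T

theorem norm_rankOne_le (x y : H) : ‖rankOne x y‖ ≤ ‖x‖ * ‖y‖ := by
  have := norm_le_tsum (ι := Unit) (f := fun _ => x) (g := fun _ => y) (Summable.of_finite)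
    (rankOne x y) (fun T => by simp)
  simpa using this

theorem tendsto_sum_rankOne {f g : ℕ → H} {h : TraceClass H} (hr : Represents f g h.1) :
    Tendsto (fun n => ∑ k ∈ Finset.range n, rankOne (f k) (g k)) atTop (𝓝 h) := by
  have bound : ∀ n, ‖h - ∑ k ∈ Finset.range n, rankOne (f k) (g k)‖ ≤
      ∑' i, ‖f (i + n)‖ * ‖g (i + n)‖ := by
    intro n
    have hsn : Summable (fun i => ‖f (i + n)‖ * ‖g (i + n)‖) :=
      (summable_nat_add_iff (f := fun i => ‖f i‖ * ‖g i‖) n).2 hr.summable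
    refine norm_le_tsum (f := fun i => f (i + n)) (g := fun i => g (i + n)) hsn _ fun T => ?_
    have e3 := summable_term hr.summable T
    have e4 := e3.sum_add_tsum_nat_add n
    have e5 : pairing T h = ∑' i, inner ℂ (g i) (T (f i)) := hr.2.2 T
    rw [pairing_sub, pairing_sum, e5, ← e4]
    simp
  rw [tendsto_iff_norm_sub_tendsto_zero]
  refine squeeze_zero (fun n => norm_nonneg _) (fun n => ?_)
    (tendsto_sum_nat_add (fun i => ‖f i‖ * ‖g i‖))
  rw [norm_sub_rev]
  exact bound n

theorem rankOne_add_left (x x' y : H) : rankOne (x + x') y = rankOne x y + rankOne x' y := by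
  ext T; simp
theorem rankOne_add_right (x y y' : H) : rankOne x (y + y') = rankOne x y + rankOne x y' := by
  ext T; simp
theorem rankOne_smul_left (c : ℂ) (x y : H) : rankOne (c • x) y = c • rankOne x y := by
  ext T; simp
theorem rankOne_smul_right (c : ℂ) (x y : H) :
    rankOne x (c • y) = (starRingEnd ℂ) c • rankOne x y := by
  ext T; simp [mul_comm]

theorem eq_of_pairing_eq {S T : H →L[ℂ] H} (h : ∀ k : TraceClass H, pairing S k = pairing T k) :
    S = T := by
  ext x
  refine ext_inner_left ℂ fun y => ?_
  simpa using h (rankOne x y)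

/-- `B(H)` is the dual of the space of trace class operators. -/
theorem existsUnique_pairing_eq [CompleteSpace H] (L : TraceClass H →L[ℂ] ℂ) :
    ∃! S : H →L[ℂ] H, ∀ h, pairing S h = L h := by
  let B₀ : H →ₗ⋆[ℂ] H →ₗ[ℂ] ℂ :=
    { toFun := fun y =>
        { toFun := fun x => L (rankOne x y)
          map_add' := fun x x' => by rw [rankOne_add_left, map_add]
          map_smul' := fun c x => by rw [rankOne_smul_left, map_smul]; rfl }
      map_add' := fun y y' => by
        ext x
        change L (rankOne x (y + y')) = L (rankOne x y) + L (rankOne x y')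
        rw [rankOne_add_right, map_add]
      map_smul' := fun c y => by
        ext x
        change L (rankOne x (c • y)) = (starRingEnd ℂ) c • L (rankOne x y)
        rw [rankOne_smul_right, map_smul] }
  let B : H →L⋆[ℂ] H →L[ℂ] ℂ := B₀.mkContinuous₂ ‖L‖ fun y x => by
    calc ‖L (rankOne x y)‖ ≤ ‖L‖ * ‖rankOne x y‖ := L.le_opNorm _
      _ ≤ ‖L‖ * (‖x‖ * ‖y‖) := by gcongr; exact norm_rankOne_le x y
      _ = ‖L‖ * ‖y‖ * ‖x‖ := by ring
  have hB : ∀ x y, B y x = L (rankOne x y) := fun x y => rfl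
  -- the operator `S₀` with `(S₀ y, x) = B y x`; its adjoint is the operator we want
  let S₀ : H →L[ℂ] H := InnerProductSpace.continuousLinearMapOfBilin B
  have hS₀ : ∀ x y, inner ℂ (S₀ y) x = L (rankOne x y) := fun x y =>
    InnerProductSpace.continuousLinearMapOfBilin_apply B y x
  refine ⟨ContinuousLinearMap.adjoint S₀, fun h => ?_, fun S' hS' => ?_⟩
  · obtain ⟨f, g, hr⟩ := h.2
    have t1 := ((pairingCLM (ContinuousLinearMap.adjoint S₀)).continuous.tendsto h).comp
      (tendsto_sum_rankOne (h := h) hr)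
    have t2 := (L.continuous.tendsto h).comp (tendsto_sum_rankOne (h := h) hr)
    refine tendsto_nhds_unique t1 (t2.congr fun n => ?_)
    simp [map_sum, ContinuousLinearMap.adjoint_inner_right, hS₀]
  · refine eq_of_pairing_eq fun k => ?_
    rw [hS']
    obtain ⟨f, g, hr⟩ := k.2
    have t1 := ((pairingCLM (ContinuousLinearMap.adjoint S₀)).continuous.tendsto k).comp
      (tendsto_sum_rankOne (h := k) hr)
    have t2 := (L.continuous.tendsto k).comp (tendsto_sum_rankOne (h := k) hr)
    refine tendsto_nhds_unique t2 (t1.congr fun n => ?_)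
    simp [map_sum, ContinuousLinearMap.adjoint_inner_right, hS₀]

variable [CompleteSpace H]

/-- The predual of the map `T ↦ V T V*` on `B(H)`, that is, `⟨T, conj V h⟩ₜ = ⟨V T V*, h⟩ₜ`. -/
def conj (V : H →L[ℂ] H) (h : TraceClass H) : TraceClass H :=
  ⟨h.1.comp ((ContinuousLinearMap.compL ℂ H H H V).comp
      ((ContinuousLinearMap.compL ℂ H H H).flip (ContinuousLinearMap.adjoint V))), by
    obtain ⟨f, g, hr⟩ := h.2
    have hb : ∀ x : H, ‖ContinuousLinearMap.adjoint V x‖ ^ 2 ≤ ‖V‖ ^ 2 * ‖x‖ ^ 2 := fun x => by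
      rw [← mul_pow]
      gcongr
      simpa using (ContinuousLinearMap.adjoint V).le_opNorm x
    refine ⟨fun i => ContinuousLinearMap.adjoint V (f i),
      fun i => ContinuousLinearMap.adjoint V (g i), ?_, ?_, fun T => ?_⟩
    · exact Summable.of_nonneg_of_le (fun i => by positivity) (fun i => hb _) (hr.1.mul_left _)
    · exact Summable.of_nonneg_of_le (fun i => by positivity) (fun i => hb _) (hr.2.1.mul_left _)
    · have := hr.2.2 (V ∘L T ∘L ContinuousLinearMap.adjoint V)
      simpa [ContinuousLinearMap.adjoint_inner_left] using! this⟩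

theorem pairing_conj (V T : H →L[ℂ] H) (h : TraceClass H) :
    pairing T (conj V h) = pairing (V ∘L T ∘L ContinuousLinearMap.adjoint V) h := rfl

end TraceClass

end Duality
section Translation

open scoped Pointwise

variable {G : Type*} [TopologicalSpace G] [Group G] [IsTopologicalGroup G] [LocallyCompactSpace G]

/-- The modular function `Δ` of `G`, normalised by `ν (E r) = Δ r * ν E` for a left Haar measure
`ν`, equivalently `∫ f (s r) dν(s) = Δ(r)⁻¹ ∫ f dν`; it is the inverse of Mathlib's character. -/
def modular (r : G) : ℝ := ((Measure.modularCharacterFun r : ℝ≥0) : ℝ)⁻¹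

theorem modular_pos (r : G) : 0 < modular r :=
  inv_pos.2 (NNReal.coe_pos.2 (Measure.modularCharacterFun_pos r))

theorem modular_mul (r s : G) : modular (r * s) = modular r * modular s := by
  simp [modular, Measure.modularCharacterFun_map_mul, mul_comm]

theorem modular_one : modular (1 : G) = 1 := by
  simp [modular, Measure.modularCharacterFun_map_one]

variable [MeasurableSpace G] [BorelSpace G] (ν : Measure G) [ν.IsHaarMeasure] [ν.Regular]

theorem map_mul_right (r : G) : ν.map (· * r) = Measure.modularCharacterFun r • ν := by
  rw [Measure.modularCharacterFun_eq_haarScalarFactor ν r]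
  have : (ν.map (· * r)).Regular := Measure.Regular.map (Homeomorph.mulRight r)
  exact Measure.isMulLeftInvariant_eq_smul_of_regular _ ν

theorem quasiMeasurePreserving_mul_right' (r : G) :
    Measure.QuasiMeasurePreserving (· * r) ν ν := by
  refine ⟨measurable_mul_const r, ?_⟩
  rw [map_mul_right]
  exact Measure.smul_absolutelyContinuous

theorem eLpNorm_translate {p : ℝ≥0∞} (hp : p ≠ ∞) (r : G) (f : G → ℂ)
    (hf : AEStronglyMeasurable f ν) :
    eLpNorm (fun s => ((modular r ^ (1 / p.toReal) : ℝ) : ℂ) * f (s * r)) p ν = eLpNorm f p ν := by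
  have hc : 0 < Measure.modularCharacterFun r := Measure.modularCharacterFun_pos r
  have h1 : eLpNorm (fun s => f (s * r)) p ν =
      (Measure.modularCharacterFun r : ℝ≥0∞) ^ (1 / p.toReal) * eLpNorm f p ν := by
    have : eLpNorm f p (ν.map (· * r)) = eLpNorm (f ∘ (· * r)) p ν :=
      eLpNorm_map_measure (hf.mono_ac (quasiMeasurePreserving_mul_right' ν r).absolutelyContinuous)
        (measurable_mul_const r).aemeasurable
    rw [map_mul_right] at this
    have h2 : eLpNorm f p (Measure.modularCharacterFun r • ν) =
      (Measure.modularCharacterFun r : ℝ≥0∞) ^ (1 / p.toReal) * eLpNorm f p ν := by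
      have := eLpNorm_smul_measure_of_ne_top (μ := ν) hp f (Measure.modularCharacterFun r : ℝ≥0∞)
      simpa [ENNReal.toReal_div] using! this
    rw [h2] at this
    exact this.symm
  have h3 := eLpNorm_const_smul (((modular r ^ (1 / p.toReal) : ℝ) : ℂ)) (fun s => f (s * r)) p ν
  have h4 : ‖((modular r ^ (1 / p.toReal) : ℝ) : ℂ)‖ₑ =
      ((Measure.modularCharacterFun r : ℝ≥0∞) ^ (1 / p.toReal))⁻¹ := by
    rw [← ENNReal.coe_rpow_of_ne_zero hc.ne', ← ENNReal.coe_inv (by positivity), ← ofReal_norm,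
      Complex.norm_real, Real.norm_of_nonneg (Real.rpow_nonneg (modular_pos r).le _), modular,
      Real.inv_rpow (NNReal.coe_nonneg _), ← NNReal.coe_rpow, ← NNReal.coe_inv,
      ENNReal.ofReal_coe_nnreal]
  refine h3.trans ?_
  rw [h1, h4, ← mul_assoc, ENNReal.inv_mul_cancel, one_mul]
  · simp [hc.ne']
  · simp [hc.ne']

variable (p : ℝ≥0∞) [Fact (1 ≤ p)] [Fact (p ≠ ∞)]

theorem memLp_translate (r : G) (f : Lp ℂ p ν) :
    MemLp (fun s => ((modular r ^ (1 / p.toReal) : ℝ) : ℂ) * f (s * r)) p ν := by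
  refine ⟨?_, ?_⟩
  · exact ((Lp.aestronglyMeasurable f).comp_quasiMeasurePreserving
      (quasiMeasurePreserving_mul_right' ν r)).const_mul _
  · rw [eLpNorm_translate ν Fact.out r f (Lp.aestronglyMeasurable f)]
    exact Lp.eLpNorm_lt_top f

/-- The right translation `(R_r f)(s) = Δ(r)^{1/p} f(s r)` on `L^p(G)`, a linear isometry. -/
def rightTranslation (r : G) : Lp ℂ p ν →ₗᵢ[ℂ] Lp ℂ p ν where
  toFun f := (memLp_translate ν p r f).toLp
  map_add' f g := by
    rw [← MemLp.toLp_add]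
    refine MemLp.toLp_congr _ _ ?_
    filter_upwards [(quasiMeasurePreserving_mul_right' ν r).ae (Lp.coeFn_add f g)] with s hs
    rw [hs, Pi.add_apply, mul_add]
    rfl
  map_smul' c f := by
    rw [RingHom.id_apply, ← MemLp.toLp_const_smul]
    refine MemLp.toLp_congr _ _ ?_
    filter_upwards [(quasiMeasurePreserving_mul_right' ν r).ae (Lp.coeFn_smul c f)] with s hs
    simp only [hs, Pi.smul_apply, smul_eq_mul]
    ring
  norm_map' f := by
    change ‖(memLp_translate ν p r f).toLp‖ = ‖f‖
    rw [Lp.norm_toLp, eLpNorm_translate ν Fact.out r f (Lp.aestronglyMeasurable f), Lp.norm_def]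

theorem coeFn_rightTranslation (r : G) (f : Lp ℂ p ν) :
    rightTranslation ν p r f =ᵐ[ν]
      fun s => ((modular r ^ (1 / p.toReal) : ℝ) : ℂ) * f (s * r) :=
  (memLp_translate ν p r f).coeFn_toLp

theorem rightTranslation_mul (r t : G) (f : Lp ℂ p ν) :
    rightTranslation ν p (r * t) f = rightTranslation ν p r (rightTranslation ν p t f) := by
  refine Lp.ext ?_
  filter_upwards [coeFn_rightTranslation ν p (r * t) f,
    coeFn_rightTranslation ν p r (rightTranslation ν p t f),
    (quasiMeasurePreserving_mul_right' ν r).ae (coeFn_rightTranslation ν p t f)] with s h1 h2 h3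
  rw [h1, h2, h3, modular_mul, Real.mul_rpow (modular_pos r).le (modular_pos t).le, mul_assoc s r t]
  push_cast
  ring

theorem rightTranslation_one (f : Lp ℂ p ν) : rightTranslation ν p 1 f = f := by
  refine Lp.ext ?_
  filter_upwards [coeFn_rightTranslation ν p 1 f] with s h1
  rw [h1, modular_one]
  simp

theorem continuousOn_integral_mul_right {f : G → ℝ} (hf : Continuous f) (hc : HasCompactSupport f)
    {N : Set G} (hN : IsCompact N) : ContinuousOn (fun r => ∫ s, f (s * r) ∂ν) N := by
  refine continuousOn_integral_of_compact_support (k := tsupport f * N⁻¹)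
    (hc.isCompact.mul hN.inv) ?_ ?_
  · exact (hf.comp (continuous_snd.mul continuous_fst)).continuousOn
  · intro r s hr hs
    by_contra h
    exact hs ⟨s * r, subset_tsupport f h, r⁻¹, Set.inv_mem_inv.2 hr, by simp⟩

theorem continuous_modular : Continuous (modular : G → ℝ) := by
  let ν : Measure G := Measure.haar
  obtain ⟨⟨f, f_cont⟩, f_comp, f_nonneg, f_one⟩ :
    ∃ f : C(G, ℝ), HasCompactSupport f ∧ 0 ≤ f ∧ f 1 ≠ 0 := exists_continuous_nonneg_pos 1
  have hpos : 0 < ∫ x, f x ∂ν :=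
    f_cont.integral_pos_of_hasCompactSupport_nonneg_nonzero f_comp f_nonneg f_one
  have key : ∀ r : G, (modular r)⁻¹ = (∫ s, f (s * r) ∂ν) / ∫ s, f s ∂ν := by
    intro r
    have h1 : ∫ s, f (s * r) ∂ν = ∫ s, f s ∂(ν.map (· * r)) :=
      (integral_map (measurable_mul_const r).aemeasurable f_cont.aestronglyMeasurable).symm
    rw [h1, map_mul_right, integral_smul_nnreal_measure, modular, inv_inv, NNReal.smul_def,
      smul_eq_mul]
    field_simp
  have hcont : Continuous fun r : G => (modular r)⁻¹ := by
    refine continuous_iff_continuousAt.2 fun r => ?_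
    obtain ⟨N, hN, hr⟩ := exists_compact_mem_nhds r
    simp only [key]
    exact ((continuousOn_integral_mul_right ν f_cont f_comp hN).continuousAt hr).div_const _
  exact (hcont.inv₀ fun r => (inv_pos.2 (modular_pos r)).ne').congr fun r => inv_inv _

theorem exists_continuous_approx [T2Space G] {q : ℝ≥0∞} (hq : q ≠ ∞) {t : Set G}
    (ht : MeasurableSet t) (hνt : ν t < ∞) {ε : ℝ≥0∞} (hε : ε ≠ 0) :
    ∃ g : G → ℝ, Continuous g ∧ HasCompactSupport g ∧
      eLpNorm (fun x => g x - t.indicator (fun _ => (1 : ℝ)) x) q ν ≤ ε := by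
  obtain ⟨η, η_pos, hη⟩ : ∃ η : ℝ≥0, 0 < η ∧ ∀ s : Set G, ν s ≤ η →
      eLpNorm (s.indicator fun _x => (1 : ℝ)) q ν ≤ ε := exists_eLpNorm_indicator_le hq 1 hε
  have hη2 : ((η / 2 : ℝ≥0) : ℝ≥0∞) ≠ 0 := by
    exact ENNReal.coe_ne_zero.2 (by positivity)
  obtain ⟨K, Kt, hK, hKc, hνK⟩ :=
    ht.exists_isCompact_isClosed_sdiff_lt hνt.ne hη2
  obtain ⟨U, KU, hU, -, hνU⟩ := hKc.measurableSet.exists_isOpen_sdiff_lt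
    (((measure_mono Kt).trans_lt hνt).ne) hη2
  obtain ⟨g, g1, g0, gc, gI⟩ := exists_continuous_one_zero_of_isCompact hK hU.isClosed_compl
    (Set.disjoint_compl_right_iff_subset.2 KU)
  refine ⟨g, g.continuous, gc, ?_⟩
  refine le_trans (eLpNorm_mono (g := ((U \ K) ∪ (t \ K)).indicator fun _ => (1 : ℝ)) ?_) (hη _ ?_)
  · intro x
    by_cases hxK : x ∈ K
    · simp [g1 hxK, Kt hxK]
    · have h1 := gI x
      by_cases hxU : x ∈ U
      · have : x ∈ (U \ K) ∪ (t \ K) := Or.inl ⟨hxU, hxK⟩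
        rw [Set.indicator_of_mem this, norm_one, Real.norm_eq_abs, abs_le]
        by_cases hxt : x ∈ t
        · rw [Set.indicator_of_mem hxt]; constructor <;> linarith [h1.1, h1.2]
        · rw [Set.indicator_of_notMem hxt]; constructor <;> linarith [h1.1, h1.2]
      · have hg : g x = 0 := g0 hxU
        by_cases hxt : x ∈ t
        · have : x ∈ (U \ K) ∪ (t \ K) := Or.inr ⟨hxt, hxK⟩
          rw [Set.indicator_of_mem this, Set.indicator_of_mem hxt, hg]; simp
        · rw [Set.indicator_of_notMem hxt, hg]; simp
  · calc ν ((U \ K) ∪ (t \ K)) ≤ ν (U \ K) + ν (t \ K) := measure_union_le _ _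
      _ ≤ ((η / 2 : ℝ≥0) : ℝ≥0∞) + ((η / 2 : ℝ≥0) : ℝ≥0∞) := add_le_add hνU.le hνK.le
      _ = η := by rw [← ENNReal.coe_add, add_halves]

theorem continuous_rightTranslation_toLp {g : G → ℂ} (hg : Continuous g)
    (hgc : HasCompactSupport g) :
    Continuous fun r => rightTranslation ν p r (hg.memLp_of_hasCompactSupport hgc).toLp := by
  have hp1 : (1 : ℝ≥0∞) ≤ p := Fact.out
  have hp : p ≠ ∞ := Fact.out
  have hp0 : p ≠ 0 := (zero_lt_one.trans_le hp1).ne'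
  have hq : 0 < p.toReal := ENNReal.toReal_pos hp0 hp
  set F : Lp ℂ p ν := (hg.memLp_of_hasCompactSupport hgc).toLp with hF
  let w : G → ℂ := fun r => ((modular r ^ (1 / p.toReal) : ℝ) : ℂ)
  have hw : Continuous w := Complex.continuous_ofReal.comp
    (continuous_modular.rpow_const fun r => Or.inl (modular_pos r).ne')
  have hR : ∀ r, rightTranslation ν p r F =ᵐ[ν] fun s => w r * g (s * r) := by
    intro r
    filter_upwards [coeFn_rightTranslation ν p r F,
      (quasiMeasurePreserving_mul_right' ν r).ae
        (MemLp.coeFn_toLp (hg.memLp_of_hasCompactSupport hgc))] with s h1 h2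
    rw [h1, h2]
  refine continuous_iff_continuousAt.2 fun r₀ => ?_
  obtain ⟨N, hN, hr₀⟩ := exists_compact_mem_nhds r₀
  have hcont : ContinuousOn
      (fun r => ∫ s, ‖w r * g (s * r) - w r₀ * g (s * r₀)‖ ^ p.toReal ∂ν) N := by
    refine continuousOn_integral_of_compact_support (k := tsupport g * N⁻¹)
      (hgc.isCompact.mul hN.inv) ?_ ?_
    · refine Continuous.continuousOn ?_
      refine Continuous.rpow_const ?_ fun _ => Or.inr hq.le
      have h1 : Continuous fun x : G × G => w x.1 * g (x.2 * x.1) :=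
        (hw.comp continuous_fst).mul (hg.comp (continuous_snd.mul continuous_fst))
      have h2 : Continuous fun x : G × G => w r₀ * g (x.2 * r₀) :=
        continuous_const.mul (hg.comp (continuous_snd.mul continuous_const))
      exact (h1.sub h2).norm
    · intro r s hr hs
      have hz : ∀ r ∈ N, g (s * r) = 0 := by
        intro r hr
        by_contra h
        exact hs ⟨s * r, subset_tsupport g h, r⁻¹, Set.inv_mem_inv.2 hr, by simp⟩
      rw [hz r hr, hz r₀ (mem_of_mem_nhds hr₀)]
      simp [hq.ne']
  have hlim := (hcont.continuousAt hr₀).tendsto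
  simp only [sub_self, norm_zero, Real.zero_rpow hq.ne', integral_zero] at hlim
  have hlim2 := hlim.rpow_const (p := p.toReal⁻¹) (Or.inr (by positivity))
  rw [Real.zero_rpow (inv_pos.2 hq).ne'] at hlim2
  rw [ContinuousAt, tendsto_iff_norm_sub_tendsto_zero]
  refine hlim2.congr fun r => ?_
  have hmem := Lp.memLp (rightTranslation ν p r F - rightTranslation ν p r₀ F)
  rw [Lp.norm_def, hmem.eLpNorm_eq_integral_rpow_norm hp0 hp, ENNReal.toReal_ofReal]
  · congr 1
    refine integral_congr_ae ?_
    filter_upwards [hR r, hR r₀, Lp.coeFn_sub (rightTranslation ν p r F)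
      (rightTranslation ν p r₀ F)] with s h1 h2 h3
    rw [h3, Pi.sub_apply, h1, h2]
  · exact Real.rpow_nonneg (integral_nonneg fun s => Real.rpow_nonneg (norm_nonneg _) _) _

theorem continuous_rightTranslation_of_approx {f : Lp ℂ p ν}
    (h : ∀ ε > 0, ∃ g : Lp ℂ p ν, ‖f - g‖ < ε ∧ Continuous fun r => rightTranslation ν p r g) :
    Continuous fun r => rightTranslation ν p r f := by
  refine continuous_of_uniform_approx_of_continuous ?_
  rw [Metric.uniformity_basis_dist_le.forall_iff (fun _ _ hst ⟨F, hF, h⟩ =>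
    ⟨F, hF, fun y => hst (h y)⟩)]
  intro ε hε
  obtain ⟨g, hg, hgc⟩ := h ε hε
  refine ⟨_, hgc, fun r => ?_⟩
  change dist _ _ ≤ ε
  rw [dist_eq_norm, ← map_sub, LinearIsometry.norm_map]
  exact hg.le

/-- Right translation is strongly continuous on `L^p(G)` for `1 ≤ p < ∞`. -/
theorem continuous_rightTranslation [T2Space G] (f : Lp ℂ p ν) :
    Continuous fun r => rightTranslation ν p r f := by
  have hp : p ≠ ∞ := Fact.out
  refine Lp.induction hp (motive := fun f => Continuous fun r => rightTranslation ν p r f)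
    ?_ ?_ ?_ f
  · intro c t ht hνt
    have hone : Continuous fun r => rightTranslation ν p r
        (indicatorConstLp p ht hνt.ne (1 : ℂ)) := by
      refine continuous_rightTranslation_of_approx ν p fun ε hε => ?_
      obtain ⟨g, hg, hgc, hle⟩ := exists_continuous_approx ν hp ht hνt
        (ε := ENNReal.ofReal (ε / 2)) (by simpa using hε)
      have hg' : Continuous fun x => (g x : ℂ) := Complex.continuous_ofReal.comp hg
      have hgc' : HasCompactSupport fun x => (g x : ℂ) :=
        hgc.comp_left (g := fun x : ℝ => (x : ℂ)) (by simp)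
      refine ⟨_, ?_, continuous_rightTranslation_toLp ν p hg' hgc'⟩
      rw [norm_sub_rev, indicatorConstLp, ← MemLp.toLp_sub, Lp.norm_toLp]
      have hle' : eLpNorm ((fun x => (g x : ℂ)) - t.indicator fun _ => (1 : ℂ)) p ν ≤
          ENNReal.ofReal (ε / 2) := by
        refine le_trans (le_of_eq (eLpNorm_congr_norm_ae (Eventually.of_forall fun x => ?_))) hle
        by_cases hx : x ∈ t
        · simp only [Pi.sub_apply, Set.indicator_of_mem hx]
          rw [← Complex.ofReal_one, ← Complex.ofReal_sub, Complex.norm_real]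
        · simp [hx]
      exact (ENNReal.toReal_mono ENNReal.ofReal_ne_top hle').trans_lt
        (by rw [ENNReal.toReal_ofReal (by positivity)]; linarith)
    have hsm : (Lp.simpleFunc.indicatorConst p ht hνt.ne c : Lp ℂ p ν) =
        c • indicatorConstLp p ht hνt.ne (1 : ℂ) := by
      rw [Lp.simpleFunc.coe_indicatorConst, indicatorConstLp, indicatorConstLp,
        ← MemLp.toLp_const_smul]
      refine MemLp.toLp_congr _ _ (Eventually.of_forall fun x => ?_)
      by_cases hx : x ∈ t <;> simp [hx]
    rw [hsm]
    simpa using! hone.const_smul c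
  · intro f g hf hg _ h1 h2
    simpa using! h1.add h2
  · have : {f : Lp ℂ p ν | Continuous fun r => rightTranslation ν p r f} =
        closure {f : Lp ℂ p ν | Continuous fun r => rightTranslation ν p r f} := by
      refine subset_antisymm subset_closure fun f hf => ?_
      refine continuous_rightTranslation_of_approx ν p fun ε hε => ?_
      obtain ⟨g, hg, hfg⟩ := Metric.mem_closure_iff.1 hf ε hε
      exact ⟨g, by rwa [← dist_eq_norm], hg⟩
    rw [this]
    exact isClosed_closure

end Translation
section MeasureAlgebra

theorem isFiniteMeasure_variation {X : Type*} [MeasurableSpace X] (μ : ComplexMeasure X) :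
    IsFiniteMeasure μ.variation := by
  have h1 : IsFiniteMeasure (VectorMeasure.variation (ComplexMeasure.re μ)) := by
    rw [← SignedMeasure.totalVariation_eq_variation, SignedMeasure.totalVariation]
    infer_instance
  have h2 : IsFiniteMeasure (VectorMeasure.variation (ComplexMeasure.im μ)) := by
    rw [← SignedMeasure.totalVariation_eq_variation, SignedMeasure.totalVariation]
    infer_instance
  refine isFiniteMeasure_of_le (VectorMeasure.variation (ComplexMeasure.re μ) +
    VectorMeasure.variation (ComplexMeasure.im μ)) ?_
  refine VectorMeasure.variation_le_of_forall_enorm_le fun E _ => ?_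
  have e1 : ‖μ E‖ₑ ≤ ‖(μ E).re‖ₑ + ‖(μ E).im‖ₑ := by
    rw [← ofReal_norm, ← ofReal_norm, ← ofReal_norm, ← ENNReal.ofReal_add (norm_nonneg _)
      (norm_nonneg _)]
    exact ENNReal.ofReal_le_ofReal (Complex.norm_le_abs_re_add_abs_im _)
  refine e1.trans ?_
  rw [Measure.add_apply]
  exact add_le_add (VectorMeasure.enorm_measure_le_variation (ComplexMeasure.re μ) E)
    (VectorMeasure.enorm_measure_le_variation (ComplexMeasure.im μ) E)

/-- The integral `∫ φ dμ` of a (Banach space valued) function against a complex measure. -/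
def integralC {X E : Type*} [MeasurableSpace X] [NormedAddCommGroup E] [NormedSpace ℂ E]
    (μ : ComplexMeasure X) (φ : X → E) : E :=
  μ.integral φ (ContinuousLinearMap.lsmul ℝ ℂ).flip

theorem integrable_of_continuous {X : Type*} [TopologicalSpace X] [MeasurableSpace X]
    [OpensMeasurableSpace X] (μ : ComplexMeasure X) {φ : X → ℂ} (hφ : Continuous φ) {C : ℝ}
    (hC : ∀ x, ‖φ x‖ ≤ C) : μ.Integrable φ := by
  have := isFiniteMeasure_variation μ
  exact Integrable.of_bound hφ.aestronglyMeasurable C (Eventually.of_forall hC)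

theorem integralC_add {X : Type*} [MeasurableSpace X] {μ : ComplexMeasure X} {φ ψ : X → ℂ}
    (hφ : μ.Integrable φ) (hψ : μ.Integrable ψ) :
    integralC μ (fun x => φ x + ψ x) = integralC μ φ + integralC μ ψ :=
  VectorMeasure.integral_fun_add hφ hψ

theorem integralC_const_mul {X : Type*} [MeasurableSpace X] (μ : ComplexMeasure X) (c : ℂ)
    (φ : X → ℂ) : integralC μ (fun x => c * φ x) = c * integralC μ φ := by
  have := setToFun_smul (μ := μ.variation)
    (dominatedFinMeasAdditive_cbmApplyMeasure μ
      (ContinuousLinearMap.lsmul ℝ ℂ (E := ℂ)).flip)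
    (fun (c : ℂ) s x => by
      simp [VectorMeasure.transpose]
      ring) c φ
  exact this

theorem norm_integralC_le {X : Type*} [MeasurableSpace X] (μ : ComplexMeasure X) {φ : X → ℂ}
    {C : ℝ} (hC : ∀ x, ‖φ x‖ ≤ C) :
    ‖integralC μ φ‖ ≤
      C * ‖(ContinuousLinearMap.lsmul ℝ ℂ (E := ℂ)).flip‖ * μ.variation.real Set.univ := by
  have := isFiniteMeasure_variation μ
  exact VectorMeasure.norm_integral_le_of_norm_le_const (Eventually.of_forall hC)

end MeasureAlgebra

section Harmonic

variable {G : Type*} [TopologicalSpace G] [Group G] [IsTopologicalGroup G] [LocallyCompactSpace G]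
  [MeasurableSpace G] [BorelSpace G] (ν : Measure G) [ν.IsHaarMeasure] [ν.Regular]

instance fact_one_ne_top : Fact ((1 : ℝ≥0∞) ≠ ∞) := ⟨ENNReal.one_ne_top⟩
instance fact_two_ne_top : Fact ((2 : ℝ≥0∞) ≠ ∞) := ⟨ENNReal.ofNat_ne_top⟩

variable (G) in
/-- The measure algebra `M(G)`: complex Borel measures on `G` whose total variation is a regular
measure (all complex Borel measures, if `G` is second countable). -/
abbrev MeasureAlgebra : Type _ := {μ : ComplexMeasure G // μ.variation.Regular}

/-- The Hilbert space `L²(G)`. -/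
abbrev L2 : Type _ := Lp ℂ 2 ν

/-- The right regular representation `(ρ_r f)(s) = Δ(r)^{1/2} f(s r)` on `L²(G)`. -/
def rightRegular (r : G) : L2 ν →L[ℂ] L2 ν :=
  (rightTranslation ν 2 r).toContinuousLinearMap

theorem coeFn_rightRegular (r : G) (f : L2 ν) :
    rightRegular ν r f =ᵐ[ν] fun s => ((modular r ^ (1 / 2 : ℝ) : ℝ) : ℂ) * f (s * r) := by
  simpa using! coeFn_rightTranslation ν 2 r f

theorem norm_rightRegular_apply (r : G) (f : L2 ν) : ‖rightRegular ν r f‖ = ‖f‖ :=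
  (rightTranslation ν 2 r).norm_map f

theorem adjoint_rightRegular (r : G) :
    ContinuousLinearMap.adjoint (rightRegular ν r) = rightRegular ν r⁻¹ := by
  symm
  rw [ContinuousLinearMap.eq_adjoint_iff]
  intro x y
  have h : rightTranslation ν 2 r (rightTranslation ν 2 r⁻¹ x) = x := by
    rw [← rightTranslation_mul, mul_inv_cancel, rightTranslation_one]
  calc inner ℂ (rightTranslation ν 2 r⁻¹ x) y
      = inner ℂ (rightTranslation ν 2 r (rightTranslation ν 2 r⁻¹ x))
          (rightTranslation ν 2 r y) := ((rightTranslation ν 2 r).inner_map_map _ _).symm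
    _ = inner ℂ x (rightTranslation ν 2 r y) := by rw [h]

/-- `Ad ρ_r (T) = ρ_r T ρ_r*`. -/
def adRho (r : G) (T : L2 ν →L[ℂ] L2 ν) : L2 ν →L[ℂ] L2 ν :=
  rightRegular ν r ∘L T ∘L ContinuousLinearMap.adjoint (rightRegular ν r)

theorem norm_adRho_le (r : G) (T : L2 ν →L[ℂ] L2 ν) : ‖adRho ν r T‖ ≤ ‖T‖ := by
  refine ContinuousLinearMap.opNorm_le_bound _ (norm_nonneg _) fun x => ?_
  rw [adRho, adjoint_rightRegular]
  change ‖rightRegular ν r (T (rightRegular ν r⁻¹ x))‖ ≤ _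
  rw [norm_rightRegular_apply]
  refine (T.le_opNorm _).trans ?_
  rw [norm_rightRegular_apply]

theorem norm_pairing_adRho_le (T : L2 ν →L[ℂ] L2 ν) (h : TraceClass (L2 ν)) (r : G) :
    ‖TraceClass.pairing (adRho ν r T) h‖ ≤ ‖T‖ * ‖h‖ :=
  (TraceClass.norm_pairing_le _ h).trans
    (mul_le_mul_of_nonneg_right (norm_adRho_le ν r T) (norm_nonneg _))

theorem continuous_pairing_adRho [T2Space G] (T : L2 ν →L[ℂ] L2 ν) (h : TraceClass (L2 ν)) :
    Continuous fun r => TraceClass.pairing (adRho ν r T) h := by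
  obtain ⟨f, g, hr⟩ := h.2
  have hc : ∀ x : L2 ν, Continuous fun r : G => rightRegular ν r⁻¹ x := fun x =>
    (continuous_rightTranslation ν 2 x).comp continuous_inv
  have e : ∀ r, TraceClass.pairing (adRho ν r T) h =
      ∑' i, inner ℂ (rightRegular ν r⁻¹ (g i)) (T (rightRegular ν r⁻¹ (f i))) := by
    intro r
    refine (hr.2.2 _).trans (tsum_congr fun i => ?_)
    rw [← adjoint_rightRegular, ContinuousLinearMap.adjoint_inner_left]
    rfl
  simp only [e]
  refine continuous_tsum (u := fun i => ‖T‖ * (‖f i‖ * ‖g i‖)) (fun i => ?_)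
    (hr.summable.mul_left _) fun i r => ?_
  · exact (hc (g i)).inner (T.continuous.comp (hc (f i)))
  · refine (norm_term_le T _ _).trans ?_
    rw [norm_rightRegular_apply, norm_rightRegular_apply]

theorem existsUnique_theta [T2Space G] (μ : MeasureAlgebra G) (T : L2 ν →L[ℂ] L2 ν) :
    ∃! S : L2 ν →L[ℂ] L2 ν, ∀ h : TraceClass (L2 ν),
      TraceClass.pairing S h = integralC μ.1 fun r => TraceClass.pairing (adRho ν r T) h := by
  have hint : ∀ h : TraceClass (L2 ν),
      μ.1.Integrable fun r => TraceClass.pairing (adRho ν r T) h := fun h =>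
    integrable_of_continuous μ.1 (continuous_pairing_adRho ν T h) (norm_pairing_adRho_le ν T h)
  let L₀ : TraceClass (L2 ν) →ₗ[ℂ] ℂ :=
    { toFun := fun h => integralC μ.1 fun r => TraceClass.pairing (adRho ν r T) h
      map_add' := fun h k => integralC_add (hint h) (hint k)
      map_smul' := fun c h => integralC_const_mul μ.1 c _ }
  let L : TraceClass (L2 ν) →L[ℂ] ℂ := L₀.mkContinuous
    (‖T‖ * ‖(ContinuousLinearMap.lsmul ℝ ℂ (E := ℂ)).flip‖ * μ.1.variation.real Set.univ)
    fun h => by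
      refine (norm_integralC_le μ.1 (norm_pairing_adRho_le ν T h)).trans (le_of_eq ?_)
      ring
  exact TraceClass.existsUnique_pairing_eq L

/-- The operator `Θ(μ)(T)`, determined by
`⟨Θ(μ)(T), h⟩ₜ = ∫ ⟨Ad ρ_r (T), h⟩ₜ dμ(r)` for every trace class `h`. -/
def Theta [T2Space G] (μ : MeasureAlgebra G) (T : L2 ν →L[ℂ] L2 ν) : L2 ν →L[ℂ] L2 ν :=
  (existsUnique_theta ν μ T).choose

theorem pairing_Theta [T2Space G] (μ : MeasureAlgebra G) (T : L2 ν →L[ℂ] L2 ν)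
    (h : TraceClass (L2 ν)) : TraceClass.pairing (Theta ν μ T) h =
      integralC μ.1 fun r => TraceClass.pairing (adRho ν r T) h :=
  (existsUnique_theta ν μ T).choose_spec.1 h

/-- The predual `θ_r` of `Ad ρ_r`. -/
def thetaPoint (r : G) (h : TraceClass (L2 ν)) : TraceClass (L2 ν) :=
  TraceClass.conj (rightRegular ν r) h

theorem pairing_thetaPoint (r : G) (T : L2 ν →L[ℂ] L2 ν) (h : TraceClass (L2 ν)) :
    TraceClass.pairing T (thetaPoint ν r h) = TraceClass.pairing (adRho ν r T) h := rfl

/-- `θ(f)(h) = ∫ f(r) θ_r(h) dr`, an integral in the Banach space of trace class operators,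
for `f ∈ L¹(G)`. -/
def theta (f : Lp ℂ 1 ν) (h : TraceClass (L2 ν)) : TraceClass (L2 ν) :=
  ∫ r, f r • thetaPoint ν r h ∂ν

/-- `Ran J`, the closed linear span in trace norm of all `θ(f)(h)`, `f ∈ J`, `h` trace class. -/
def Ran (J : Submodule ℂ (Lp ℂ 1 ν)) : Submodule ℂ (TraceClass (L2 ν)) :=
  (Submodule.span ℂ {k | ∃ f ∈ J, ∃ h : TraceClass (L2 ν), k = theta ν f h}).topologicalClosure

/-- The annihilator in `B(H)` of a space of trace class operators. -/
def annihilator {H : Type*} [NormedAddCommGroup H] [InnerProductSpace ℂ H]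
    (S : Submodule ℂ (TraceClass H)) : Set (H →L[ℂ] H) :=
  {T | ∀ h ∈ S, TraceClass.pairing T h = 0}

/-- The convolution `f ∗ μ = ∫ f ∗ δ_y dμ(y)` in `L¹(G)`, where
`(f ∗ δ_y)(x) = Δ(y⁻¹) f(x y⁻¹)`; so `(f ∗ μ)(x) = ∫ Δ(y⁻¹) f(x y⁻¹) dμ(y)`. -/
def convolution (f : Lp ℂ 1 ν) (μ : MeasureAlgebra G) : Lp ℂ 1 ν :=
  integralC μ.1 fun y => rightTranslation ν 1 y⁻¹ f

/-- `J_Λ`, the closed linear span in `L¹(G)` of all `f ∗ μ - f` with `f ∈ L¹(G)`, `μ ∈ Λ`. -/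
def harmonicIdeal (Λ : Set (MeasureAlgebra G)) : Submodule ℂ (Lp ℂ 1 ν) :=
  (Submodule.span ℂ {u | ∃ f : Lp ℂ 1 ν, ∃ μ ∈ Λ, u = convolution ν f μ - f}).topologicalClosure

/-- The jointly `Λ`-harmonic operators: `Θ(μ)(T) = T` for all `μ ∈ Λ`. -/
def harmonicOperators [T2Space G] (Λ : Set (MeasureAlgebra G)) : Set (L2 ν →L[ℂ] L2 ν) :=
  {T | ∀ μ ∈ Λ, Theta ν μ T = T}

end Harmonic

end JointlyHarmonic

end

noncomputable section

open MeasureTheory Filter Topology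
open scoped ENNReal NNReal

namespace JointlyHarmonic

/-! The core is a duality: under the trace pairing, `Theta ν μ` is adjoint to convolution by `μ`, in
the sense that ⟨T, θ(f ∗ μ)h⟩ = ⟨Θ(μ)T, θ(f)h⟩ (`pairing_theta_convolution`). For a point mass at y
this is the substitution r ↦ ry⁻¹ in ∫ f(r) ⟨Ad ρ_r (Ad ρ_y T), h⟩ dr: the factor Δ(y⁻¹) of the L¹
translation cancels the scaling of left Haar measure (`pairing_theta_rightTranslation`). Integrating
in y against μ gives the general case, since f ↦ ⟨T, θ(f)h⟩ is a bounded functional on L¹(G).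

Hence ⟨T, θ(f ∗ μ - f)h⟩ = ⟨Θ(μ)T - T, θ(f)h⟩. If T is harmonic, the right side vanishes, and
continuity extends this from the generators to all of `harmonicIdeal` and `Ran`. Conversely, if the
left side vanishes for all f and h, then Θ(μ)T = T, because the elements θ(f)(h) separate operators
(`eq_of_pairing_theta_eq`): r ↦ ⟨Ad ρ_r S, h⟩ is continuous, so its integrals against test functions
determine its value ⟨S, h⟩ at the identity.

The analytic cost lies in the vector-valued integrals defining `theta` and `convolution`. Neither G
nor the Banach spaces involved need be separable or σ-finite, so strong measurability of continuous
integrands is derived from regularity of the measures. -/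

/-! ### Strong measurability of continuous vector-valued functions -/

/-- The obstruction is that `φ` may have non-separable range. Its image of a compact set is compact,
hence separable, and inner regularity exhausts a set of finite measure by countably many compact
sets up to a null set. -/
theorem aestronglyMeasurable_restrict_of_continuous {X E : Type*} [TopologicalSpace X] [R1Space X]
    [MeasurableSpace X] [BorelSpace X] [NormedAddCommGroup E] {μ : Measure X} [μ.Regular] {t : Set X}
    (ht : MeasurableSet t) (hμt : μ t ≠ ∞) {φ : X → E} (hφ : Continuous φ) :
    AEStronglyMeasurable φ (μ.restrict t) := by
  have hK : ∀ n : ℕ, ∃ K ⊆ t, IsCompact K ∧ IsClosed K ∧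
      μ (t \ K) < ENNReal.ofReal (1 / (n + 1 : ℝ)) := fun n =>
    ht.exists_isCompact_isClosed_sdiff_lt hμt (by simp; positivity)
  choose K hKt hKc hKcl hK using hK
  have h0 : Tendsto (fun n : ℕ => ENNReal.ofReal (1 / (n + 1 : ℝ))) atTop (𝓝 0) := by
    simpa using ENNReal.tendsto_ofReal tendsto_one_div_add_atTop_nhds_zero_nat
  have hnull : μ (t \ ⋃ n, K n) = 0 := le_antisymm (ge_of_tendsto' h0 fun n =>
    (measure_mono (Set.sdiff_subset_sdiff_right (Set.subset_iUnion K n))).trans (hK n).le) zero_le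
  have hae : (⋃ n, K n : Set X) =ᵐ[μ] t :=
    (Set.iUnion_subset hKt).eventuallyLE.antisymm (ae_le_set.2 hnull)
  rw [← Measure.restrict_congr_set hae, aestronglyMeasurable_iUnion_iff]
  exact fun n => hφ.continuousOn.aestronglyMeasurable_of_isCompact (hKc n) (hKcl n).measurableSet

/-- An integrable function times a continuous one, with values in any normed space, is almost
everywhere strongly measurable for a regular measure. -/
theorem aestronglyMeasurable_smul_of_continuous {X E : Type*} [TopologicalSpace X] [R1Space X]
    [MeasurableSpace X] [BorelSpace X] [NormedAddCommGroup E] [NormedSpace ℂ E] {μ : Measure X}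
    [μ.Regular] {f : X → ℂ} (hf : Integrable f μ) {φ : X → E} (hφ : Continuous φ) :
    AEStronglyMeasurable (fun x => f x • φ x) μ := by
  obtain ⟨f₀, hf₀, hff₀⟩ := hf.1
  -- `μ` need not be σ-finite, but an integrable function lives on a σ-finite set: these level sets
  -- have finite measure and cover the points where `f₀` is nonzero.
  let t : ℕ → Set X := fun n => {x | 1 / (n + 1 : ℝ) ≤ ‖f₀ x‖}
  have ht : ∀ n, MeasurableSet (t n) := fun n =>
    measurableSet_le measurable_const hf₀.norm.measurable
  have hμt : ∀ n, μ (t n) ≠ ∞ := fun n =>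
    ((hf.congr hff₀).measure_norm_ge_lt_top (by positivity)).ne
  have hU : AEStronglyMeasurable (fun x => f₀ x • φ x) (μ.restrict (⋃ n, t n)) := by
    rw [aestronglyMeasurable_iUnion_iff]
    exact fun n => hf₀.aestronglyMeasurable.smul
      (aestronglyMeasurable_restrict_of_continuous (ht n) (hμt n) hφ)
  have e : (⋃ n, t n).indicator (fun x => f₀ x • φ x) = fun x => f₀ x • φ x := by
    rw [Set.indicator_eq_self]
    intro x hx
    have hx0 : f₀ x ≠ 0 := fun h => hx (by simp [h])
    obtain ⟨n, hn⟩ := exists_nat_one_div_lt (norm_pos_iff.2 hx0)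
    exact Set.mem_iUnion.2 ⟨n, hn.le⟩
  rw [← aestronglyMeasurable_indicator_iff (MeasurableSet.iUnion ht), e] at hU
  refine hU.congr ?_
  filter_upwards [hff₀] with x hx
  rw [hx]

theorem integrable_smul_of_continuous {X E : Type*} [TopologicalSpace X] [R1Space X]
    [MeasurableSpace X] [BorelSpace X] [NormedAddCommGroup E] [NormedSpace ℂ E] {μ : Measure X}
    [μ.Regular] {f : X → ℂ} (hf : Integrable f μ) {φ : X → E} (hφ : Continuous φ) {C : ℝ} (hC : ∀ x, ‖φ x‖ ≤ C) : Integrable (fun x => f x • φ x) μ := by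
  refine (hf.norm.mul_const C).mono' (aestronglyMeasurable_smul_of_continuous hf hφ)
    (Eventually.of_forall fun x => ?_)
  rw [norm_smul]
  gcongr
  exact hC x

/-! ### Integrals against complex measures -/

/-- Bounded linear maps commute with integration against a complex measure. -/
theorem integralC_comp {X E : Type*} [MeasurableSpace X] [NormedAddCommGroup E]
    [NormedSpace ℂ E] [CompleteSpace E] (μ : ComplexMeasure X) (L : E →L[ℂ] ℂ) {φ : X → E}
    (hφ : μ.Integrable φ) : integralC μ (fun x => L (φ x)) = L (integralC μ φ) := by
  have hfin := isFiniteMeasure_variation μ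
  refine Integrable.induction (μ := μ.variation)
    (fun φ => integralC μ (fun x => L (φ x)) = L (integralC μ φ)) ?_ ?_ ?_ ?_ hφ
  · intro c s hs hμs
    have e : (fun x => L (s.indicator (fun _ => c) x)) = s.indicator (fun _ => L c) := by
      ext x
      by_cases hx : x ∈ s <;> simp [hx]
    -- On an indicator both integrals are the complex number `μ s` acting on a vector, so complex
    -- linearity of `L` is what is needed.
    rw [e, integralC, integralC, VectorMeasure.integral, VectorMeasure.integral,
      setToFun_indicator_const _ hs hμs.ne, setToFun_indicator_const _ hs hμs.ne]
    change μ s • L c = L (μ s • c)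
    rw [map_smul]
  · intro f g _ hf hg h1 h2
    have e1 : integralC μ (f + g) = integralC μ f + integralC μ g :=
      VectorMeasure.integral_fun_add hf hg
    simp only [Pi.add_apply, map_add]
    rw [integralC_add (L.integrable_comp hf) (L.integrable_comp hg), h1, h2, e1, map_add]
  -- Closedness in L¹: both sides are continuous in `f`, once post-composition with `L` is viewed as
  -- the bounded map `L.compLpL` between L¹ spaces.
  · have c1 : Continuous fun f : X →₁[μ.variation] E => integralC μ f :=
      continuous_setToFun _
    have c2 : Continuous fun f : X →₁[μ.variation] ℂ => integralC μ f :=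
      continuous_setToFun _
    have e : ∀ f : X →₁[μ.variation] E,
        integralC μ (fun x => L (f x)) = integralC μ (L.compLpL 1 μ.variation f) := fun f =>
      VectorMeasure.integral_congr_ae (EventuallyEq.symm (L.coeFn_compLp f))
    simp only [e]
    exact isClosed_eq (c2.comp (L.compLpL 1 μ.variation).continuous) (L.continuous.comp c1)
  · intro f g hfg hf h
    have e1 : integralC μ g = integralC μ f := VectorMeasure.integral_congr_ae hfg.symm
    have e2 : integralC μ (fun x => L (g x)) = integralC μ (fun x => L (f x)) :=
      VectorMeasure.integral_congr_ae (hfg.symm.fun_comp L)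
    rw [e1, e2, h]

/-! ### Rank-one elements and test functions -/

/-- A bounded sesquilinear map is jointly continuous: the difference splits into one term per
variable. This transfers strong continuity of ρ to trace-norm continuity of `thetaPoint`. -/
theorem continuous_rankOne {H : Type*} [NormedAddCommGroup H] [InnerProductSpace ℂ H] :
    Continuous fun p : H × H => TraceClass.rankOne p.1 p.2 := by
  refine continuous_iff_continuousAt.2 fun p => ?_
  rw [ContinuousAt, tendsto_iff_norm_sub_tendsto_zero]
  have hb : ∀ q : H × H, ‖TraceClass.rankOne q.1 q.2 - TraceClass.rankOne p.1 p.2‖ ≤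
      ‖q.1 - p.1‖ * ‖q.2‖ + ‖p.1‖ * ‖q.2 - p.2‖ := fun q => by
    have e : TraceClass.rankOne q.1 q.2 - TraceClass.rankOne p.1 p.2 =
        TraceClass.rankOne (q.1 - p.1) q.2 + TraceClass.rankOne p.1 (q.2 - p.2) := by
      ext T
      simp [TraceClass.pairing_sub]
    rw [e]
    exact (norm_add_le _ _).trans
      (add_le_add (TraceClass.norm_rankOne_le _ _) (TraceClass.norm_rankOne_le _ _))
  refine squeeze_zero (fun _ => norm_nonneg _) hb ?_
  have hc : Continuous fun q : H × H => ‖q.1 - p.1‖ * ‖q.2‖ + ‖p.1‖ * ‖q.2 - p.2‖ := by fun_prop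
  simpa using hc.tendsto p

/-- A continuous function on `G` which is orthogonal to all compactly supported continuous
functions vanishes at the identity. -/
theorem apply_one_eq_zero_of_forall_integral {G : Type*} [TopologicalSpace G] [Group G]
    [IsTopologicalGroup G] [LocallyCompactSpace G] [MeasurableSpace G] [BorelSpace G]
    (ν : Measure G) [ν.IsHaarMeasure] {K : G → ℂ} (hK : Continuous K)
    (h : ∀ g : G → ℂ, Continuous g → HasCompactSupport g → ∫ r, g r * K r ∂ν = 0) : K 1 = 0 := by
  obtain ⟨⟨w, w_cont⟩, w_comp, w_nonneg, w_one⟩ :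
    ∃ w : C(G, ℝ), HasCompactSupport w ∧ 0 ≤ w ∧ w 1 ≠ 0 := exists_continuous_nonneg_pos 1
  have hwc : HasCompactSupport fun r => (w r : ℂ) :=
    HasCompactSupport.comp_left (g := fun x : ℝ => (x : ℂ)) w_comp (by simp)
  -- Testing against `w` times the conjugate of `K` turns the integrand into `w * ‖K‖ ^ 2`, which is
  -- continuous, nonnegative and compactly supported. If `K 1 ≠ 0` it is nonzero at 1, so its Haar
  -- integral would be positive.
  have h0 := h (fun r => (w r : ℂ) * (starRingEnd ℂ) (K r))
    ((Complex.continuous_ofReal.comp w_cont).mul (Complex.continuous_conj.comp hK)) hwc.mul_right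
  have hzero : ∫ r, w r * ‖K r‖ ^ 2 ∂ν = 0 := by
    rw [← Complex.ofReal_eq_zero, ← integral_complex_ofReal, ← h0]
    refine integral_congr_ae (Eventually.of_forall fun r => ?_)
    change ((w r * ‖K r‖ ^ 2 : ℝ) : ℂ) = (w r : ℂ) * (starRingEnd ℂ) (K r) * K r
    rw [mul_assoc, Complex.conj_mul']
    push_cast
    rfl
  by_contra hne
  have hc : Continuous fun r => w r * ‖K r‖ ^ 2 := w_cont.mul (hK.norm.pow 2)
  have hcs : HasCompactSupport fun r => w r * ‖K r‖ ^ 2 := HasCompactSupport.mul_right w_comp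
  exact (hc.integral_pos_of_hasCompactSupport_nonneg_nonzero (μ := ν) (x := 1) hcs
    (fun r => mul_nonneg (w_nonneg r) (by positivity))
    (mul_ne_zero w_one (pow_ne_zero _ (norm_ne_zero_iff.2 hne)))).ne' hzero

/-! ### Integrability on G and the action of `thetaPoint` on the trace class -/

section Harmonic

variable {G : Type*} [TopologicalSpace G] [Group G] [IsTopologicalGroup G] [LocallyCompactSpace G]
  [MeasurableSpace G] [BorelSpace G] (ν : Measure G) [ν.IsHaarMeasure] [ν.Regular]

/-- Regularity of the variation, built into `MeasureAlgebra`, enters here. It makes the L¹-valued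
integral in `convolution` a genuine one rather than the default value 0. -/
theorem integrable_of_continuous_of_bounded {E : Type*} [NormedAddCommGroup E] [NormedSpace ℂ E]
    (μ : MeasureAlgebra G) {φ : G → E} (hφ : Continuous φ) {C : ℝ} (hC : ∀ x, ‖φ x‖ ≤ C) :
    μ.1.Integrable φ := by
  have h1 := isFiniteMeasure_variation μ.1
  have h2 := μ.2
  have := integrable_smul_of_continuous (μ := μ.1.variation) (f := fun _ => (1 : ℂ))
    (integrable_const _) hφ hC
  simpa using this

theorem adRho_mul (r y : G) (T : L2 ν →L[ℂ] L2 ν) :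
    adRho ν (r * y) T = adRho ν r (adRho ν y T) := by
  have h : ∀ (a b : G) (x : L2 ν),
      rightRegular ν (a * b) x = rightRegular ν a (rightRegular ν b x) := rightTranslation_mul ν 2
  ext1 x
  simp only [adRho, adjoint_rightRegular, mul_inv_rev, ContinuousLinearMap.comp_apply, h]

theorem adRho_one (T : L2 ν →L[ℂ] L2 ν) : adRho ν 1 T = T := by
  have h : ∀ x : L2 ν, rightRegular ν 1 x = x := rightTranslation_one ν 2
  ext1 x
  simp only [adRho, adjoint_rightRegular, inv_one, ContinuousLinearMap.comp_apply, h]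

theorem thetaPoint_sub (r : G) (h k : TraceClass (L2 ν)) :
    thetaPoint ν r (h - k) = thetaPoint ν r h - thetaPoint ν r k := rfl

theorem thetaPoint_rankOne (r : G) (x y : L2 ν) :
    thetaPoint ν r (TraceClass.rankOne x y) =
      TraceClass.rankOne (rightRegular ν r⁻¹ x) (rightRegular ν r⁻¹ y) := by
  ext T
  rw [pairing_thetaPoint, TraceClass.pairing_rankOne, TraceClass.pairing_rankOne,
    ← adjoint_rightRegular, ContinuousLinearMap.adjoint_inner_left]
  rfl

/-- Applying the isometry `rightRegular ν r⁻¹` to every vector of a representation of `h` represents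
`thetaPoint ν r h` with the same sum of products of norms. -/
theorem norm_thetaPoint_le (r : G) (h : TraceClass (L2 ν)) : ‖thetaPoint ν r h‖ ≤ ‖h‖ := by
  refine le_of_forall_pos_le_add fun ε hε => ?_
  obtain ⟨f, g, hr, hc⟩ := TraceClass.exists_lt h hε
  refine le_trans ?_ hc.le
  have h1 := TraceClass.norm_le_tsum (f := fun i => rightRegular ν r⁻¹ (f i))
    (g := fun i => rightRegular ν r⁻¹ (g i)) (by simpa [norm_rightRegular_apply] using hr.summable)
    (thetaPoint ν r h) fun T => by
      rw [pairing_thetaPoint]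
      refine (hr.2.2 _).trans (tsum_congr fun i => ?_)
      rw [← adjoint_rightRegular, ContinuousLinearMap.adjoint_inner_left]
      rfl
  simpa [norm_rightRegular_apply] using h1

/-- `θ_r` as a bounded operator on the trace class. -/
def thetaPointCLM (r : G) : TraceClass (L2 ν) →L[ℂ] TraceClass (L2 ν) :=
  LinearMap.mkContinuous
    { toFun := thetaPoint ν r
      map_add' := fun _ _ => rfl
      map_smul' := fun _ _ => rfl } 1 fun h => by
    rw [one_mul]
    exact norm_thetaPoint_le ν r h

/-- The kernel of a bounded functional is a closed subspace, so vanishing on a closed span need only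
be tested on generators. The next lemma rests on the same fact in L¹(G). -/
theorem mem_annihilator_Ran_iff {T : L2 ν →L[ℂ] L2 ν} {J : Submodule ℂ (Lp ℂ 1 ν)} :
    T ∈ annihilator (Ran ν J) ↔
      ∀ f ∈ J, ∀ h : TraceClass (L2 ν), TraceClass.pairing T (theta ν f h) = 0 := by
  constructor
  · intro hT f hf h
    exact hT _ (Submodule.le_topologicalClosure _ (Submodule.subset_span ⟨f, hf, h, rfl⟩))
  · intro hT k hk
    have hle : Ran ν J ≤ LinearMap.ker (TraceClass.pairingCLM T).toLinearMap := by
      refine Submodule.topologicalClosure_minimal _ (Submodule.span_le.2 ?_)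
        (TraceClass.pairingCLM T).isClosed_ker
      rintro _ ⟨f, hf, h, rfl⟩
      exact hT f hf h
    exact hle hk

theorem forall_mem_harmonicIdeal_iff {Λ : Set (MeasureAlgebra G)} (L : Lp ℂ 1 ν →L[ℂ] ℂ) :
    (∀ f ∈ harmonicIdeal ν Λ, L f = 0) ↔
      ∀ f : Lp ℂ 1 ν, ∀ μ ∈ Λ, L (convolution ν f μ - f) = 0 := by
  constructor
  · intro hL f μ hμ
    exact hL _ (Submodule.le_topologicalClosure _ (Submodule.subset_span ⟨f, μ, hμ, rfl⟩))
  · intro hL f hf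
    have hle : harmonicIdeal ν Λ ≤ LinearMap.ker L.toLinearMap := by
      refine Submodule.topologicalClosure_minimal _ (Submodule.span_le.2 ?_) L.isClosed_ker
      rintro _ ⟨f, μ, hμ, rfl⟩
      exact hL f μ hμ
    exact hle hf

variable [T2Space G]

/-- Since every `thetaPoint ν r` is a contraction, truncating a rank-one expansion of `h` gives an
approximation uniform in `r`. Each truncation is continuous by strong continuity of ρ and
`continuous_rankOne`. -/
theorem continuous_thetaPoint (h : TraceClass (L2 ν)) : Continuous fun r => thetaPoint ν r h := by
  obtain ⟨f, g, hr⟩ := h.2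
  have hlim := TraceClass.tendsto_sum_rankOne (h := h) hr
  have hc : ∀ x : L2 ν, Continuous fun r : G => rightRegular ν r⁻¹ x := fun x =>
    (continuous_rightTranslation ν 2 x).comp continuous_inv
  refine continuous_of_uniform_approx_of_continuous ?_
  rw [Metric.uniformity_basis_dist_le.forall_iff (fun _ _ hst ⟨F, hF, h⟩ =>
    ⟨F, hF, fun y => hst (h y)⟩)]
  intro ε hε
  obtain ⟨n, hn⟩ := (Metric.tendsto_atTop.1 hlim ε hε)
  refine ⟨fun r => thetaPoint ν r (∑ k ∈ Finset.range n, TraceClass.rankOne (f k) (g k)), ?_,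
    fun r => ?_⟩
  · have e : ∀ r, thetaPoint ν r (∑ k ∈ Finset.range n, TraceClass.rankOne (f k) (g k)) =
        ∑ k ∈ Finset.range n,
          TraceClass.rankOne (rightRegular ν r⁻¹ (f k)) (rightRegular ν r⁻¹ (g k)) := fun r => by
      simp only [← thetaPoint_rankOne]
      exact map_sum (thetaPointCLM ν r) _ _
    simp only [e]
    exact continuous_finsetSum _ fun k _ =>
      continuous_rankOne.comp ((hc (f k)).prodMk (hc (g k)))
  · change dist _ _ ≤ ε
    rw [dist_eq_norm, ← thetaPoint_sub]
    refine (norm_thetaPoint_le ν r _).trans ?_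
    have := (hn n le_rfl).le
    rwa [dist_comm, dist_eq_norm] at this

/-- Guarantees that the Bochner integral defining `theta` does not fall back on its default value 0,
so bounded functionals may be moved inside it. -/
theorem integrable_smul_thetaPoint (f : Lp ℂ 1 ν) (h : TraceClass (L2 ν)) :
    Integrable (fun r => f r • thetaPoint ν r h) ν :=
  integrable_smul_of_continuous (L1.integrable_coeFn f) (continuous_thetaPoint ν h)
    fun r => norm_thetaPoint_le ν r h

theorem pairing_theta (T : L2 ν →L[ℂ] L2 ν) (f : Lp ℂ 1 ν) (h : TraceClass (L2 ν)) :
    TraceClass.pairing T (theta ν f h) = ∫ r, f r * TraceClass.pairing (adRho ν r T) h ∂ν := by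
  have := (TraceClass.pairingCLM T).integral_comp_comm (integrable_smul_thetaPoint ν f h)
  simpa [pairing_thetaPoint] using! this.symm

/-- `f ↦ θ(f)(h)` as a bounded operator on `L¹(G)`. -/
def thetaCLM (h : TraceClass (L2 ν)) : Lp ℂ 1 ν →L[ℂ] TraceClass (L2 ν) :=
  LinearMap.mkContinuous
    { toFun := fun f => theta ν f h
      map_add' := fun f g => by
        rw [theta, theta, theta, ← integral_add (integrable_smul_thetaPoint ν f h)
          (integrable_smul_thetaPoint ν g h)]
        refine integral_congr_ae ?_
        filter_upwards [Lp.coeFn_add f g] with r hr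
        rw [hr, Pi.add_apply, add_smul]
      map_smul' := fun c f => by
        rw [theta, theta, RingHom.id_apply, ← integral_smul]
        refine integral_congr_ae ?_
        filter_upwards [Lp.coeFn_smul c f] with r hr
        rw [hr, Pi.smul_apply, smul_assoc] } ‖h‖ fun f => by
    rw [mul_comm, L1.norm_eq_integral_norm, ← integral_mul_const]
    refine norm_integral_le_of_norm_le ((L1.integrable_coeFn f).norm.mul_const _)
      (Eventually.of_forall fun r => ?_)
    rw [norm_smul]
    gcongr
    exact norm_thetaPoint_le ν r h

@[simp] theorem thetaCLM_apply (f : Lp ℂ 1 ν) (h : TraceClass (L2 ν)) :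
    thetaCLM ν h f = theta ν f h := rfl

/-! ### Duality between convolution and `Theta` -/

/-- The point-mass case of the duality: translating `f` on L¹(G) is absorbed by a change of
variable, which moves `y` onto the operator through `adRho_mul`. -/
theorem pairing_theta_rightTranslation (T : L2 ν →L[ℂ] L2 ν) (f : Lp ℂ 1 ν)
    (h : TraceClass (L2 ν)) (y : G) :
    TraceClass.pairing T (theta ν (rightTranslation ν 1 y⁻¹ f) h) =
      TraceClass.pairing (adRho ν y T) (theta ν f h) := by
  rw [pairing_theta, pairing_theta]
  -- `F` is the right-hand integrand. Since Ad ρ at `r * y⁻¹` followed by Ad ρ at `y` is Ad ρ at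
  -- `r`, the value `F (r * y⁻¹)` is the left-hand integrand without its modular factor.
  set F : G → ℂ := fun r => f r * TraceClass.pairing (adRho ν r (adRho ν y T)) h with hF
  have hFm : AEStronglyMeasurable F ν := (L1.integrable_coeFn f).1.mul
    (continuous_pairing_adRho ν (adRho ν y T) h).aestronglyMeasurable
  have e1 : ∫ r, F (r * y⁻¹) ∂ν = ∫ r, F r ∂(ν.map (· * y⁻¹)) :=
    (integral_map (measurable_mul_const _).aemeasurable
      (hFm.mono_ac (quasiMeasurePreserving_mul_right' ν y⁻¹).absolutelyContinuous)).symm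
  rw [map_mul_right, integral_smul_nnreal_measure] at e1
  -- This factor is exactly the weight in `rightTranslation ν 1 y⁻¹`, where the exponent `1 /
  -- p.toReal` equals 1.
  have e2 : ∫ r, F r ∂ν = (modular y⁻¹ : ℂ) * ∫ r, F (r * y⁻¹) ∂ν := by
    rw [e1, modular, NNReal.smul_def, Complex.real_smul, ← mul_assoc, ← Complex.ofReal_mul,
      inv_mul_cancel₀ (NNReal.coe_pos.2 (Measure.modularCharacterFun_pos y⁻¹)).ne']
    simp
  rw [e2, ← integral_const_mul]
  refine integral_congr_ae ?_
  filter_upwards [coeFn_rightTranslation ν 1 y⁻¹ f] with r hr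
  rw [hr, hF]
  simp only [← adRho_mul, inv_mul_cancel_right]
  simp [mul_assoc]

/-- Integrates the point-mass identity against `μ`. One side is then the definition of `Theta`
tested on `theta ν f h`, and on the other a bounded functional on L¹(G) is pulled out of the
integral defining `convolution`. -/
theorem pairing_theta_convolution (T : L2 ν →L[ℂ] L2 ν) (f : Lp ℂ 1 ν) (μ : MeasureAlgebra G)
    (h : TraceClass (L2 ν)) :
    TraceClass.pairing T (theta ν (convolution ν f μ) h) =
      TraceClass.pairing (Theta ν μ T) (theta ν f h) := by
  rw [pairing_Theta]
  simp only [← pairing_theta_rightTranslation]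
  have hint : μ.1.Integrable fun y => rightTranslation ν 1 y⁻¹ f :=
    integrable_of_continuous_of_bounded μ
      ((continuous_rightTranslation ν 1 f).comp continuous_inv)
      fun y => ((rightTranslation ν 1 y⁻¹).norm_map f).le
  exact (integralC_comp μ.1 ((TraceClass.pairingCLM T).comp (thetaCLM ν h)) hint).symm

/-! ### Separation of operators and the main equality -/

/-- The elements `θ(f)(h)` separate the points of `B(L²(G))`. -/
theorem eq_of_pairing_theta_eq {S T : L2 ν →L[ℂ] L2 ν}
    (hST : ∀ (f : Lp ℂ 1 ν) (h : TraceClass (L2 ν)),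
      TraceClass.pairing S (theta ν f h) = TraceClass.pairing T (theta ν f h)) : S = T := by
  refine TraceClass.eq_of_pairing_eq fun h => ?_
  -- This continuous function takes the value ⟨S, h⟩ - ⟨T, h⟩ at the identity; the hypothesis,
  -- applied to the L¹ classes of test functions, says that it integrates to zero against each of
  -- them.
  have hK := (continuous_pairing_adRho ν S h).sub (continuous_pairing_adRho ν T h)
  have key := apply_one_eq_zero_of_forall_integral ν hK fun g hg hgc => ?_
  · rwa [Pi.sub_apply, adRho_one, adRho_one, sub_eq_zero] at key
  have hgm : MemLp g 1 ν := hg.memLp_of_hasCompactSupport hgc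
  have hint : ∀ R : L2 ν →L[ℂ] L2 ν,
      Integrable (fun r => g r * TraceClass.pairing (adRho ν r R) h) ν := fun R =>
    (hg.mul (continuous_pairing_adRho ν R h)).integrable_of_hasCompactSupport
      (HasCompactSupport.mul_right hgc)
  have hval : ∀ R : L2 ν →L[ℂ] L2 ν, TraceClass.pairing R (theta ν (hgm.toLp g) h) =
      ∫ r, g r * TraceClass.pairing (adRho ν r R) h ∂ν := fun R => by
    rw [pairing_theta]
    refine integral_congr_ae ?_
    filter_upwards [hgm.coeFn_toLp] with r hr
    rw [hr]
  have h0 := hST (hgm.toLp g) h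
  rw [hval, hval, ← sub_eq_zero, ← integral_sub (hint S) (hint T)] at h0
  simpa only [Pi.sub_apply, mul_sub] using h0

theorem harmonicOperators_eq_annihilator_Ran (Λ : Set (MeasureAlgebra G)) :
    harmonicOperators ν Λ = annihilator (Ran ν (harmonicIdeal ν Λ)) := by
  ext T
  have key : ∀ f μ h, TraceClass.pairing T (theta ν (convolution ν f μ - f) h) =
      TraceClass.pairing (Theta ν μ T) (theta ν f h) - TraceClass.pairing T (theta ν f h) := by
    intro f μ h
    rw [← thetaCLM_apply, map_sub, TraceClass.pairing_sub, thetaCLM_apply, thetaCLM_apply,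
      pairing_theta_convolution]
  rw [mem_annihilator_Ran_iff]
  constructor
  · intro hT f hf h
    refine (forall_mem_harmonicIdeal_iff ν
      ((TraceClass.pairingCLM T).comp (thetaCLM ν h))).2 (fun f μ hμ => ?_) f hf
    refine (key f μ h).trans ?_
    rw [hT μ hμ, sub_self]
  · intro hT μ hμ
    -- By `key`, vanishing on the generators of `harmonicIdeal` says only that Θ(μ)T - T annihilates
    -- every θ(f)(h); separation upgrades this to equality of operators.
    refine eq_of_pairing_theta_eq ν fun f h => ?_
    rw [← sub_eq_zero, ← key]
    exact (forall_mem_harmonicIdeal_iff ν ((TraceClass.pairingCLM T).comp (thetaCLM ν h))).1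
      (fun f hf => hT f hf h) f μ hμ

end Harmonic

end JointlyHarmonic

end

theorem mainTheorem6 {G : Type*} [TopologicalSpace G] [Group G] [IsTopologicalGroup G]
    [LocallyCompactSpace G] [T2Space G] [MeasurableSpace G] [BorelSpace G]
    (ν : MeasureTheory.Measure G) [ν.IsHaarMeasure] [ν.Regular]
    (Λ : Set (JointlyHarmonic.MeasureAlgebra G)) :
    JointlyHarmonic.harmonicOperators ν Λ =
      JointlyHarmonic.annihilator (JointlyHarmonic.Ran ν (JointlyHarmonic.harmonicIdeal ν Λ)) := by
  exact JointlyHarmonic.harmonicOperators_eq_annihilator_Ran ν Λ
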